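/- **Setting.** Let $f_g$ be the $\mathrm{Bernoulli}(0.5)$ probability mass function on $\{0,1\}$, $F_g$ its CDF, and for $C\in[0,1]$ let the watermarked $g$-value distribution with collision probability $C$ be $$f_{gw}^{C}(v)=f_g(v)\bigl[C+(1-C)(2F_g(v)-f_g(v))\bigr],\qquad v\in\{0,1\}.$$ This is the tournament model: if $p$ is a probability distribution on a finite vocabulary $V$, with collision probability $C_p=\sum_{x\in V}p(x)^2$, two tokens are drawn independently from $p$, the tokens of $V$ receive i.i.d. $\mathrm{Bernoulli}(0.5)$ $g$-values, and the drawn token with the larger $g$-value wins (ties being broken by a fair coin), then $C_p\in[0,1]$ and the $g$-value of the winner has distribution $f_{gw}^{C_p}$. For each $k\in\mathbb N$ consider a watermarked text with $T_k$ tokens and $m_k$ tournament layers, where $m_kT_k\to\infty$ as $k\to\infty$. Let $C^{(k)}_{t,\ell}\in[0,1]$ ($1\le t\le T_k$, $1\le \ell\le m_k$) be arbitrary, and let the $g$-values $g^{(k)}_{t,\ell}$ be independent $\{0,1\}$-valued random variables (on a probability space that may depend on $k$), $g^{(k)}_{t,\ell}$ having distribution $f_{gw}^{C^{(k)}_{t,\ell}}$.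 Put $$p^{(k)}_{t,\ell}=\frac{3-C^{(k)}_{t,\ell}}{4},\qquad \mathrm{MS}_k=\frac1{m_kT_k}\sum_{t=1}^{T_k}\sum_{\ell=1}^{m_k}g^{(k)}_{t,\ell}.$$ **Statement.** The description of the tournament model above is correct, and: 1. Each $g^{(k)}_{t,\ell}$ is $\mathrm{Bernoulli}(p^{(k)}_{t,\ell})$, and $p^{(k)}_{t,\ell}\in[\tfrac12,\tfrac34]$. 2. The mean score has mean and variance $$\mathbb E[\mathrm{MS}_k]=\frac1{m_kT_k}\sum_{t,\ell}p^{(k)}_{t,\ell},\qquad \mathrm{Var}[\mathrm{MS}_k]=\Bigl(\frac1{m_kT_k}\Bigr)^2\sum_{t,\ell}p^{(k)}_{t,\ell}\bigl(1-p^{(k)}_{t,\ell}\bigr).$$ 3. The Lyapunov condition holds with $\delta=2$: with $B_k^2=\sum_{t,\ell}\mathrm{Var}[g^{(k)}_{t,\ell}]$, $$\lim_{k\to\infty}\frac1{B_k^{2+\delta}}\sum_{t,\ell}\mathbb E\Bigl[\bigl|g^{(k)}_{t,\ell}-\mathbb E[g^{(k)}_{t,\ell}]\bigr|^{2+\delta}\Bigr]=0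 .$$ 4. The mean score is asymptotically normal with this mean and variance: $$\frac{\mathrm{MS}_k-\mathbb E[\mathrm{MS}_k]}{\sqrt{\mathrm{Var}[\mathrm{MS}_k]}}\xrightarrow{\;d\;}\mathcal N(0,1)\qquad(k\to\infty).$$ -/

import Mathlib

open MeasureTheory ProbabilityTheory Filter Topology

namespace SynthID

noncomputable section

/-- The unwatermarked `g`-value distribution `f_g = Bernoulli(0.5)` on `{0, 1}`. -/
def gDist : PMF (Fin 2) := PMF.uniformOfFintype (Fin 2)

/-- The cumulative distribution function `F_g` of a `{0, 1}`-valued distribution `f`. -/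
def cdfOf (f : PMF (Fin 2)) (v : Fin 2) : ℝ := ∑ u ∈ Finset.Iic v, (f u).toReal

/-- The probability mass function of the watermarked `g`-value distribution with collision
probability `C`: `f_gw(v) = f_g(v) [C + (1 - C) (2 F_g(v) - f_g(v))]`. -/
def watermarkedPmf (f : PMF (Fin 2)) (C : ℝ) (v : Fin 2) : ℝ :=
  (f v).toReal * (C + (1 - C) * (2 * cdfOf f v - (f v).toReal))

/-- The collision probability `∑ p_i ^ 2` of a token distribution `p` on a finite vocabulary. -/
def collisionProb {V : Type*} [Fintype V] (p : PMF V) : ℝ := ∑ x, (p x).toReal ^ 2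

/-- The winner of a match between the tokens `x` and `y`: the token with the larger `g`-value;
ties are resolved by the coin `b`. -/
def winner {V : Type*} (g : V → Fin 2) (b : Bool) (x y : V) : V :=
  if g y < g x then x else if g x < g y then y else if b then x else y

open Classical in
/-- The law of the `g`-value of the winner of one layer of tournament sampling: the competing
tokens `x, y` are drawn independently from `p`, all tokens of the vocabulary receive independent
`Bernoulli(0.5)` `g`-values (that is, `g` is uniform on `V → {0, 1}`), and ties are resolved by
a fair coin. -/
def matchLaw {V : Type*} [Fintype V] (p : PMF V) : PMF (Fin 2) :=
  p.bind fun x => p.bind fun y =>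
    (PMF.uniformOfFintype (V → Fin 2)).bind fun g =>
      (PMF.uniformOfFintype Bool).bind fun b => PMF.pure (g (winner g b x y))

/-- The mean score `(1 / (T m)) ∑_{t ≤ T} ∑_{ℓ ≤ m} g_{t,ℓ}` of an array of `g`-values. -/
def meanScore {Ω : Type*} {T m : ℕ} (g : Fin T → Fin m → Ω → Fin 2) (ω : Ω) : ℝ :=
  1 / ((T : ℝ) * (m : ℝ)) * ∑ t, ∑ l, ((g t l ω : ℕ) : ℝ)

/-- The Lyapunov ratio `B ^ (-(2 + δ)) ∑_i E |X_i - E X_i| ^ (2 + δ)`, `B ^ 2 = ∑_i Var X_i`, of a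
finite family of real random variables. -/
def lyapunovRatio {Ω ι : Type*} [MeasurableSpace Ω] [Fintype ι] (P : Measure Ω)
    (X : ι → Ω → ℝ) (δ : ℝ) : ℝ :=
  1 / Real.sqrt (∑ i, Var[X i; P]) ^ (2 + δ) *
    ∑ i, ∫ ω, |X i ω - ∫ ω', X i ω' ∂P| ^ (2 + δ) ∂P

end

end SynthID

/-!
The tournament part is a count. Whatever the tie-breaking coin shows, the winner of a match between
`x` and `y` carries `max (g x) (g y)` (`apply_winner`), which is `0` exactly if `g` vanishes on
`{x, y}`. This happens with probability `1 / 2` if `x = y` and `1 / 4` otherwise, so averaging over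
`x, y` gives `1 / 4 + C_p / 4`, which is `f_gw(0)` with collision probability `C_p`. The value at
`1` follows since both sides have total mass one.

The distribution `f_gw` with parameter `C` is Bernoulli with parameter `(3 - C) / 4`; mean and
variance of the mean score follow from linearity and independence. As `C ∈ [0, 1]`, all variances
are at least `3 / 16`, while the centered variables are bounded by `1`, so their fourth moments are
at most their variances. The Lyapunov ratio of `n` such variables is hence at most `16 / (3 n)`
(`lyapunovRatio_bernoulli_le`).

Asymptotic normality is Lyapunov's central limit theorem
(`tendstoInDistribution_of_lyapunovRatio`), proved with characteristic functions. For a centered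
`Y` with variance `v`, Taylor's formula compares the characteristic function of `Y` at `t` with
`1 - t ^ 2 v / 2`, and this with `exp (-t ^ 2 v / 2)`. The errors involve `E |Y| ^ 3`, bounded
through `2 |y| ^ 3 ≤ a y ^ 2 + y ^ 4 / a`, and `v ^ 2 ≤ E Y ^ 4` (`norm_charFun_sub_exp_le`).
By independence the characteristic function of a standardized row sum is a product; telescoping
(`norm_prod_sub_prod_le_sum`) bounds its distance to `exp (-t ^ 2 / 2)` by
`4 |t| ^ 3 a + t ^ 4 a ^ 2` as soon as the Lyapunov ratio is at most `a ^ 2`. Lévy's continuity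
theorem concludes.
-/

namespace SynthID

/-! ### One layer of the tournament -/

lemma toReal_bind_apply {α β : Type*} [Fintype α] (p : PMF α) (f : α → PMF β) (b : β) :
    (p.bind f b).toReal = ∑ a, (p a).toReal * (f a b).toReal := by
  rw [PMF.bind_apply, tsum_fintype,
    ENNReal.toReal_sum fun a _ => ENNReal.mul_ne_top (p.apply_ne_top a) ((f a).apply_ne_top b)]
  simp

lemma sum_toReal_eq_one {α : Type*} [Fintype α] (p : PMF α) : ∑ a, (p a).toReal = 1 := by
  rw [← ENNReal.toReal_sum fun a _ => p.apply_ne_top a, (tsum_fintype _).symm.trans p.tsum_coe,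
    ENNReal.toReal_one]

lemma collisionProb_mem_Icc {V : Type*} [Fintype V] (p : PMF V) :
    collisionProb p ∈ Set.Icc (0 : ℝ) 1 := by
  refine ⟨Finset.sum_nonneg fun x _ => sq_nonneg _, ?_⟩
  rw [← sum_toReal_eq_one p]
  refine Finset.sum_le_sum fun x _ => ?_
  have h : (p x).toReal ≤ 1 :=
    ENNReal.toReal_le_of_le_ofReal zero_le_one (by simpa using p.coe_le_one x)
  exact pow_le_of_le_one ENNReal.toReal_nonneg h two_ne_zero

/-- Whatever the coin shows, the winner carries the larger of the two `g`-values. -/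
lemma apply_winner {V : Type*} (g : V → Fin 2) (b : Bool) (x y : V) :
    g (winner g b x y) = max (g x) (g y) := by
  unfold winner
  split_ifs <;> grind

/-- Prescribing the values on `s` divides the number of functions `V → {0, 1}` by `2 ^ #s`; in this
form no subtraction of cardinalities is needed. -/
lemma card_filter_forall_eq_zero_mul {V : Type*} [Fintype V] [DecidableEq V] (s : Finset V) :
    (Finset.univ.filter fun g : V → Fin 2 => ∀ z ∈ s, g z = 0).card * 2 ^ s.card =
      2 ^ Fintype.card V := by
  have h : (Finset.univ.filter fun g : V → Fin 2 => ∀ z ∈ s, g z = 0) =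
      Fintype.piFinset fun z => if z ∈ s then {0} else Finset.univ := by
    ext g
    simp only [Finset.mem_filter, Finset.mem_univ, true_and, Fintype.mem_piFinset]
    refine forall_congr' fun z => ?_
    by_cases hz : z ∈ s <;> simp [hz]
  have hs : (2 : ℕ) ^ s.card = ∏ z, if z ∈ s then 2 else 1 := by
    rw [Finset.prod_ite_mem]
    simp
  rw [h, Fintype.card_piFinset, hs, ← Finset.prod_mul_distrib,
    Finset.prod_congr rfl (g := fun _ => 2)]
  · simp
  · intro z _
    by_cases hz : z ∈ s <;> simp [hz]

open Classical in
/-- The larger of the `g`-values of `x` and `y` is `0` with probability `1 / 2` if `x = y` and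
`1 / 4` otherwise. -/
lemma toReal_uniform_bind_winner_zero {V : Type*} [Fintype V] (x y : V) :
    (((PMF.uniformOfFintype (V → Fin 2)).bind fun g =>
      (PMF.uniformOfFintype Bool).bind fun b => PMF.pure (g (winner g b x y))) 0).toReal =
      if x = y then 1 / 2 else 1 / 4 := by
  have hmax (g : V → Fin 2) : 0 = max (g x) (g y) ↔ ∀ z ∈ ({x, y} : Finset V), g z = 0 := by
    simp only [Finset.mem_insert, Finset.mem_singleton, forall_eq_or_imp, forall_eq]
    grind
  have hcard := card_filter_forall_eq_zero_mul ({x, y} : Finset V)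
  simp_rw [apply_winner, PMF.bind_const, toReal_bind_apply, PMF.pure_apply, hmax]
  simp only [PMF.uniformOfFintype_apply, Fintype.card_pi, Fintype.card_fin, Finset.prod_const,
    Finset.card_univ, ENNReal.toReal_inv, ENNReal.toReal_natCast, apply_ite ENNReal.toReal,
    ENNReal.toReal_one, ENNReal.toReal_zero, ← Finset.mul_sum, Finset.sum_boole]
  rw [← hcard]
  have hpos : ((Finset.univ.filter fun g : V → Fin 2 =>
      ∀ z ∈ ({x, y} : Finset V), g z = 0).card : ℝ) ≠ 0 := by
    intro h0
    rw [Nat.cast_eq_zero.1 h0, zero_mul] at hcard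
    exact absurd hcard (by positivity)
  push_cast
  rw [mul_inv, mul_comm, ← mul_assoc, mul_inv_cancel₀ hpos, one_mul]
  split_ifs with h
  · simp [h]
  · rw [Finset.card_pair h]; norm_num

lemma watermarkedPmf_gDist_zero (C : ℝ) : watermarkedPmf gDist C 0 = 1 - (3 - C) / 4 := by
  have h : (Finset.Iic 0 : Finset (Fin 2)) = {0} := by decide
  simp only [watermarkedPmf, cdfOf, gDist, h, PMF.uniformOfFintype_apply, Fintype.card_fin,
    Finset.sum_singleton, ENNReal.toReal_inv, ENNReal.toReal_natCast]
  norm_num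
  ring

lemma watermarkedPmf_gDist_one (C : ℝ) : watermarkedPmf gDist C 1 = (3 - C) / 4 := by
  have h : (Finset.Iic 1 : Finset (Fin 2)) = {0, 1} := by decide
  simp only [watermarkedPmf, cdfOf, gDist, h, PMF.uniformOfFintype_apply, Fintype.card_fin,
    ENNReal.toReal_inv, ENNReal.toReal_natCast]
  norm_num
  ring

lemma toReal_matchLaw_zero {V : Type*} [Fintype V] (p : PMF V) :
    (matchLaw p 0).toReal = 1 - (3 - collisionProb p) / 4 := by
  classical
  have hrow (x : V) : ∑ y, (p y).toReal * (if x = y then 1 / 2 else 1 / 4 : ℝ) =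
      1 / 4 + 1 / 4 * (p x).toReal := by
    have (y : V) : (p y).toReal * (if x = y then 1 / 2 else 1 / 4 : ℝ) =
        1 / 4 * (p y).toReal + if x = y then 1 / 4 * (p y).toReal else 0 := by
      split_ifs <;> ring
    simp_rw [this, Finset.sum_add_distrib, ← Finset.mul_sum, sum_toReal_eq_one]
    simp
  rw [matchLaw, toReal_bind_apply]
  simp_rw [toReal_bind_apply p, toReal_uniform_bind_winner_zero, hrow]
  have (x : V) : (p x).toReal * (1 / 4 + 1 / 4 * (p x).toReal) =
      1 / 4 * (p x).toReal + 1 / 4 * (p x).toReal ^ 2 := by ring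
  simp_rw [this, Finset.sum_add_distrib, ← Finset.mul_sum, sum_toReal_eq_one, collisionProb]
  ring

lemma toReal_matchLaw {V : Type*} [Fintype V] (p : PMF V) (v : Fin 2) :
    (matchLaw p v).toReal = watermarkedPmf gDist (collisionProb p) v := by
  have hsum := sum_toReal_eq_one (matchLaw p)
  rw [Fin.sum_univ_two, toReal_matchLaw_zero] at hsum
  fin_cases v
  · exact (toReal_matchLaw_zero p).trans (watermarkedPmf_gDist_zero _).symm
  · refine Eq.trans ?_ (watermarkedPmf_gDist_one _).symm
    simp only [Fin.mk_one]
    linarith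

/-! ### The central limit theorem for triangular arrays under Lyapunov's condition -/

/-- Telescoping bound: on the unit disc, products are as close as the sums of the distances of
their factors. -/
lemma norm_prod_sub_prod_le_sum {ι : Type*} (s : Finset ι) (a b : ι → ℂ)
    (ha : ∀ i ∈ s, ‖a i‖ ≤ 1) (hb : ∀ i ∈ s, ‖b i‖ ≤ 1) :
    ‖∏ i ∈ s, a i - ∏ i ∈ s, b i‖ ≤ ∑ i ∈ s, ‖a i - b i‖ := by
  classical
  induction s using Finset.induction with
  | empty => simp
  | insert j s hj ih =>
    have hs := ih (fun i hi => ha i (Finset.mem_insert_of_mem hi))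
      (fun i hi => hb i (Finset.mem_insert_of_mem hi))
    have hbs : ‖∏ i ∈ s, b i‖ ≤ 1 := by
      rw [norm_prod]
      exact Finset.prod_le_one (fun _ _ => norm_nonneg _)
        fun i hi => hb i (Finset.mem_insert_of_mem hi)
    rw [Finset.prod_insert hj, Finset.prod_insert hj, Finset.sum_insert hj]
    calc ‖a j * ∏ i ∈ s, a i - b j * ∏ i ∈ s, b i‖
        = ‖(a j - b j) * ∏ i ∈ s, b i + a j * (∏ i ∈ s, a i - ∏ i ∈ s, b i)‖ := by
          congr 1; ring
      _ ≤ ‖a j - b j‖ * ‖∏ i ∈ s, b i‖ + ‖a j‖ * ‖∏ i ∈ s, a i - ∏ i ∈ s, b i‖ := by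
          refine (norm_add_le _ _).trans_eq ?_
          rw [norm_mul, norm_mul]
      _ ≤ ‖a j - b j‖ * 1 + 1 * ∑ i ∈ s, ‖a i - b i‖ := by
          gcongr
          exact ha j (Finset.mem_insert_self j s)
      _ = _ := by ring

lemma norm_exp_ofReal_mul_I_sub_taylor_le (x : ℝ) :
    ‖Complex.exp (x * Complex.I) - (1 + x * Complex.I - x ^ 2 / 2)‖ ≤ 4 * |x| ^ 3 := by
  have hI : (x * Complex.I) ^ 2 = -(x : ℂ) ^ 2 := by rw [mul_pow, Complex.I_sq]; ring
  rcases le_total |x| 1 with hx | hx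
  · have h := Complex.exp_bound (x := x * Complex.I) (by simpa using hx) (n := 3) (by norm_num)
    rw [Finset.sum_range_succ, Finset.sum_range_succ, Finset.sum_range_one, hI] at h
    simp only [Nat.factorial, norm_mul, Complex.norm_real, Complex.norm_I, Real.norm_eq_abs] at h
    norm_num at h
    have h3 : 0 ≤ |x| ^ 3 := by positivity
    refine le_trans (le_of_eq ?_) (h.trans (by linarith))
    congr 1
    ring
  · have h1 : ‖(1 : ℂ) + x * Complex.I - x ^ 2 / 2‖ ≤ 1 + |x| + |x| ^ 2 / 2 := by
      refine (norm_sub_le _ _).trans (add_le_add ((norm_add_le _ _).trans ?_) ?_) <;> simp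
    have h2 := norm_sub_le (Complex.exp (x * Complex.I)) (1 + x * Complex.I - x ^ 2 / 2)
    rw [Complex.norm_exp_ofReal_mul_I] at h2
    have : |x| ^ 2 ≤ |x| ^ 3 := pow_le_pow_right₀ hx (by norm_num)
    have : |x| ≤ |x| ^ 3 := le_self_pow₀ hx (by norm_num)
    linarith

lemma abs_one_sub_sub_exp_neg_le_sq {u : ℝ} (hu : 0 ≤ u) : |1 - u - Real.exp (-u)| ≤ u ^ 2 := by
  rcases le_total u 1 with h | h
  · have := Real.abs_exp_sub_one_sub_id_le (x := -u) (by rwa [abs_neg, abs_of_nonneg hu])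
    rwa [neg_sq, abs_sub_comm,
      show -u - (Real.exp (-u) - 1) = 1 - u - Real.exp (-u) by ring] at this
  · have h1 := Real.add_one_le_exp (-u)
    have h2 := Real.exp_le_one_iff.2 (neg_nonpos.2 hu)
    rw [abs_le]
    constructor <;> nlinarith

section

variable {Ω : Type*} [MeasurableSpace Ω] {P : Measure Ω} [IsProbabilityMeasure P]

/-- Comparison of the characteristic function of a centered variable with the Gaussian one of the
same variance. The third moment in Taylor's formula is split by
`2 |y| ^ 3 ≤ a y ^ 2 + y ^ 4 / a`. -/
lemma norm_charFun_sub_exp_le {Y : Ω → ℝ} (hY : MemLp Y 4 P) (h0 : ∫ ω, Y ω ∂P = 0)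
    {a : ℝ} (ha : 0 < a) (t : ℝ) :
    ‖charFun (P.map Y) t - Real.exp (-(t ^ 2 * (∫ ω, Y ω ^ 2 ∂P) / 2))‖ ≤
      2 * |t| ^ 3 * (a * (∫ ω, Y ω ^ 2 ∂P) + (∫ ω, Y ω ^ 4 ∂P) / a) +
        t ^ 4 * (∫ ω, Y ω ^ 4 ∂P) := by
  have hm : AEMeasurable Y P := hY.aestronglyMeasurable.aemeasurable
  have hY1 : Integrable Y P := hY.integrable (by norm_num)
  have hY2 : MemLp Y 2 P := hY.mono_exponent (by norm_num)
  have hi2 : Integrable (fun ω => Y ω ^ 2) P := hY2.integrable_sq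
  have hi4 : Integrable (fun ω => Y ω ^ 4) P := by
    have := hY.integrable_norm_pow (p := 4) (by norm_num)
    refine this.congr (ae_of_all _ fun ω => ?_)
    simp [Even.pow_abs (by decide : Even 4)]
  set v := ∫ ω, Y ω ^ 2 ∂P
  set q := ∫ ω, Y ω ^ 4 ∂P
  have hv : 0 ≤ v := integral_nonneg fun ω => sq_nonneg _
  -- `q - v ^ 2` is the variance of `Y ^ 2`
  have hvq : v ^ 2 ≤ q := by
    have := integral_nonneg (μ := P) (f := fun ω => (Y ω ^ 2 - v) ^ 2) fun ω => sq_nonneg _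
    have he : ∫ ω, (Y ω ^ 2 - v) ^ 2 ∂P = q - 2 * v * v + v ^ 2 := by
      have : (fun ω => (Y ω ^ 2 - v) ^ 2) = fun ω => Y ω ^ 4 - 2 * v * Y ω ^ 2 + v ^ 2 := by
        ext ω; ring
      have hd : Integrable (fun ω => Y ω ^ 4 - 2 * v * Y ω ^ 2) P := hi4.sub (hi2.const_mul _)
      rw [this, integral_add hd (integrable_const _), integral_sub hi4 (hi2.const_mul _),
        integral_const_mul]
      simp [v, q]
    nlinarith
  have hexp : Integrable (fun ω => Complex.exp ((t * Y ω : ℝ) * Complex.I)) P := by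
    refine Integrable.of_bound (C := 1) ?_ (ae_of_all _ fun ω => ?_)
    · exact (by fun_prop : AEMeasurable _ P).aestronglyMeasurable
    · rw [Complex.norm_exp_ofReal_mul_I]
  have htay : Integrable (fun ω => (1 : ℂ) + ((t * Y ω : ℝ) : ℂ) * Complex.I -
      ((t * Y ω : ℝ) : ℂ) ^ 2 / 2) P := by
    refine ((integrable_const _).add (((hY1.const_mul t).ofReal).mul_const _)).sub ?_
    have : Integrable (fun ω => ((t ^ 2 * Y ω ^ 2 / 2 : ℝ) : ℂ)) P :=
      ((hi2.const_mul _).div_const _).ofReal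
    refine this.congr (ae_of_all _ fun ω => ?_)
    push_cast; ring
  have hchar : charFun (P.map Y) t = ∫ ω, Complex.exp ((t * Y ω : ℝ) * Complex.I) ∂P := by
    rw [charFun_apply_real, integral_map hm (by fun_prop)]
    simp
  have htayint : ∫ ω, ((1 : ℂ) + ((t * Y ω : ℝ) : ℂ) * Complex.I -
      ((t * Y ω : ℝ) : ℂ) ^ 2 / 2) ∂P = ((1 - t ^ 2 * v / 2 : ℝ) : ℂ) := by
    have h1 : Integrable (fun ω => ((t * Y ω : ℝ) : ℂ) * Complex.I) P :=
      ((hY1.const_mul t).ofReal).mul_const _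
    have h2 : (fun ω => (1 : ℂ) + ((t * Y ω : ℝ) : ℂ) * Complex.I -
        ((t * Y ω : ℝ) : ℂ) ^ 2 / 2) = fun ω => (((t * Y ω : ℝ) : ℂ) * Complex.I) +
          ((1 - t ^ 2 / 2 * Y ω ^ 2 : ℝ) : ℂ) := by
      ext ω; push_cast; ring
    have h3 : Integrable (fun ω => 1 - t ^ 2 / 2 * Y ω ^ 2) P :=
      (integrable_const _).sub (hi2.const_mul _)
    have h4 : Integrable (fun ω => ((1 - t ^ 2 / 2 * Y ω ^ 2 : ℝ) : ℂ)) P := h3.ofReal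
    rw [h2, integral_add h1 h4,
      integral_mul_const, integral_complex_ofReal, integral_complex_ofReal,
      integral_sub (integrable_const _) (hi2.const_mul _), integral_const_mul, integral_const_mul,
      h0]
    simp [v]
    ring
  have hbd : ‖charFun (P.map Y) t - ((1 - t ^ 2 * v / 2 : ℝ) : ℂ)‖ ≤
      2 * |t| ^ 3 * (a * v + q / a) := by
    rw [hchar, ← htayint, ← integral_sub hexp htay]
    have hgi : Integrable (fun ω => 2 * |t| ^ 3 * (a * Y ω ^ 2 + Y ω ^ 4 / a)) P :=
      ((hi2.const_mul _).add (hi4.div_const _)).const_mul _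
    refine (norm_integral_le_of_norm_le hgi (ae_of_all _ fun ω => ?_)).trans_eq ?_
    · refine (norm_exp_ofReal_mul_I_sub_taylor_le (t * Y ω)).trans ?_
      have hsq : 2 * |Y ω| ^ 3 ≤ a * Y ω ^ 2 + Y ω ^ 4 / a := by
        rw [← sq_abs (Y ω), ← Even.pow_abs (by decide : Even 4) (Y ω), ← sub_nonneg]
        have : a * |Y ω| ^ 2 + |Y ω| ^ 4 / a - 2 * |Y ω| ^ 3 =
            |Y ω| ^ 2 * (a - |Y ω|) ^ 2 / a := by
          field_simp; ring
        rw [this]; positivity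
      calc 4 * |t * Y ω| ^ 3 = 2 * |t| ^ 3 * (2 * |Y ω| ^ 3) := by rw [abs_mul]; ring
        _ ≤ _ := by gcongr
    · rw [integral_const_mul, integral_add (hi2.const_mul _) (hi4.div_const _),
        integral_const_mul, integral_div]
  have hexpv : ‖((1 - t ^ 2 * v / 2 : ℝ) : ℂ) - (Real.exp (-(t ^ 2 * v / 2)) : ℂ)‖ ≤
      t ^ 4 * q := by
    rw [← Complex.ofReal_sub, Complex.norm_real, Real.norm_eq_abs]
    refine (abs_one_sub_sub_exp_neg_le_sq (by positivity)).trans ?_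
    have : t ^ 4 * v ^ 2 ≤ t ^ 4 * q := by gcongr
    have : 0 ≤ t ^ 4 * v ^ 2 := by positivity
    nlinarith
  exact (norm_sub_le_norm_sub_add_norm_sub _ _ _).trans (add_le_add hbd hexpv)

/-- Quantitative Lyapunov bound for the characteristic function of a standardized sum. -/
lemma norm_charFun_sum_sub_exp_le {ι : Type*} [Fintype ι] {Y : ι → Ω → ℝ}
    (hY : ∀ i, MemLp (Y i) 4 P) (hind : iIndepFun Y P) (h0 : ∀ i, ∫ ω, Y i ω ∂P = 0)
    (h1 : ∑ i, ∫ ω, Y i ω ^ 2 ∂P = 1) {a : ℝ} (ha : 0 < a)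
    (h4 : ∑ i, ∫ ω, Y i ω ^ 4 ∂P ≤ a ^ 2) (t : ℝ) :
    ‖charFun (P.map fun ω => ∑ i, Y i ω) t - Complex.exp (-t ^ 2 / 2)‖ ≤
      4 * |t| ^ 3 * a + t ^ 4 * a ^ 2 := by
  have hm (i : ι) : AEMeasurable (Y i) P := (hY i).aestronglyMeasurable.aemeasurable
  have hexp : Complex.exp (-t ^ 2 / 2) =
      ∏ i, (Real.exp (-(t ^ 2 * (∫ ω, Y i ω ^ 2 ∂P) / 2)) : ℂ) := by
    rw [← Complex.ofReal_prod, ← Real.exp_sum, Finset.sum_neg_distrib, ← Finset.sum_div,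
      ← Finset.mul_sum, h1]
    push_cast
    congr 1; ring
  rw [hind.charFun_map_fun_sum_eq_prod hm, hexp, Finset.prod_apply]
  refine (norm_prod_sub_prod_le_sum _ _ _ (fun i _ => ?_) (fun i _ => ?_)).trans ?_
  · have := Measure.isProbabilityMeasure_map (hm i)
    exact norm_charFun_le_one t
  · rw [Complex.norm_real, Real.norm_eq_abs, Real.abs_exp, Real.exp_le_one_iff, neg_nonpos]
    have : 0 ≤ ∫ ω, Y i ω ^ 2 ∂P := integral_nonneg fun ω => sq_nonneg _
    positivity
  refine (Finset.sum_le_sum fun i _ => norm_charFun_sub_exp_le (hY i) (h0 i) ha t).trans ?_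
  rw [Finset.sum_add_distrib, ← Finset.mul_sum, ← Finset.mul_sum, Finset.sum_add_distrib,
    ← Finset.mul_sum, ← Finset.sum_div, h1]
  have : (∑ i, ∫ ω, Y i ω ^ 4 ∂P) / a ≤ a := by
    rw [div_le_iff₀ ha]; linarith
  calc _ ≤ 2 * |t| ^ 3 * (a * 1 + a) + t ^ 4 * a ^ 2 := by gcongr
    _ = _ := by ring

end

lemma lyapunovRatio_two {Ω ι : Type*} [MeasurableSpace Ω] [Fintype ι] (P : Measure Ω)
    (X : ι → Ω → ℝ) :
    lyapunovRatio P X 2 =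
      1 / Real.sqrt (∑ i, Var[X i; P]) ^ 4 * ∑ i, ∫ ω, (X i ω - ∫ ω', X i ω' ∂P) ^ 4 ∂P := by
  have h (x : ℝ) : x ^ ((2 : ℝ) + 2) = x ^ 4 := by
    rw [← Real.rpow_natCast]; norm_num
  simp_rw [lyapunovRatio, h, Even.pow_abs (by decide : Even 4)]

/-- **Lyapunov's central limit theorem** with fourth moments: the standardized row sums of a
triangular array of rowwise independent variables converge in distribution to `N(0, 1)`. Finitely
many rows may be degenerate. -/
theorem tendstoInDistribution_of_lyapunovRatio {ι : ℕ → Type*} [∀ k, Fintype (ι k)]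
    {Ω : ℕ → Type*} [∀ k, MeasurableSpace (Ω k)] {P : ∀ k, Measure (Ω k)}
    [∀ k, IsProbabilityMeasure (P k)] {X : ∀ k, ι k → Ω k → ℝ}
    (hX : ∀ k i, MemLp (X k i) 4 (P k)) (hind : ∀ k, iIndepFun (X k) (P k))
    (hvar : ∀ᶠ k in atTop, 0 < ∑ i, Var[X k i; P k])
    (hlyap : Tendsto (fun k => lyapunovRatio (P k) (X k) 2) atTop (𝓝 0)) :
    TendstoInDistribution
      (fun k ω => ∑ i, (X k i ω - ∫ ω', X k i ω' ∂(P k)) / Real.sqrt (∑ i, Var[X k i; P k]))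
      atTop (id : ℝ → ℝ) P (gaussianReal 0 1) where
  forall_aemeasurable k := Finset.aemeasurable_fun_sum _ fun i _ =>
    ((hX k i).aestronglyMeasurable.aemeasurable.sub_const _).div_const _
  tendsto := by
    refine ProbabilityMeasure.tendsto_iff_tendsto_charFun.2 fun t => ?_
    simp only [ProbabilityMeasure.coe_mk, Measure.map_id, charFun_gaussianReal]
    rw [Metric.tendsto_nhds]
    intro ε hε
    -- the error bound vanishes with `a`, so one fixed `a` serves all late rows
    obtain ⟨a, hlt, ha⟩ : ∃ a : ℝ, 4 * |t| ^ 3 * a + t ^ 4 * a ^ 2 < ε ∧ 0 < a := by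
      have hc : Tendsto (fun a : ℝ => 4 * |t| ^ 3 * a + t ^ 4 * a ^ 2) (𝓝[>] 0) (𝓝 0) := by
        have : Continuous fun a : ℝ => 4 * |t| ^ 3 * a + t ^ 4 * a ^ 2 := by fun_prop
        simpa using (this.tendsto 0).mono_left nhdsWithin_le_nhds
      exact ((hc.eventually_lt_const hε).and self_mem_nhdsWithin).exists
    filter_upwards [hvar, hlyap.eventually_le_const (show 0 < a ^ 2 by positivity)] with k hv hl
    rw [dist_eq_norm]
    have hm (i : ι k) : AEMeasurable (X k i) (P k) := (hX k i).aestronglyMeasurable.aemeasurable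
    refine lt_of_le_of_lt ?_ hlt
    have key := norm_charFun_sum_sub_exp_le (P := P k)
      (Y := fun i ω => (X k i ω - ∫ ω', X k i ω' ∂(P k)) / Real.sqrt (∑ i, Var[X k i; P k]))
      (fun i => ?_) ?_ (fun i => ?_) ?_ ha ?_ t
    · have hg : Complex.exp (t * (0 : ℝ) * Complex.I - ((1 : NNReal) : ℝ) * t ^ 2 / 2) =
          Complex.exp (-t ^ 2 / 2) := by
        simp [neg_div]
      rw [hg]
      exact key
    · simp_rw [div_eq_mul_inv]
      exact ((hX k i).sub (memLp_const _)).mul_const _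
    · exact (hind k).comp (fun i x => (x - ∫ ω', X k i ω' ∂(P k)) /
        Real.sqrt (∑ i, Var[X k i; P k])) fun i => by fun_prop
    · rw [integral_div, integral_sub ((hX k i).integrable (by norm_num)) (integrable_const _)]
      simp
    · simp_rw [div_pow, integral_div, ← variance_eq_integral (hm _), ← Finset.sum_div]
      rw [Real.sq_sqrt hv.le, div_self hv.ne']
    · rw [lyapunovRatio_two] at hl
      simp_rw [div_pow, integral_div, ← Finset.sum_div]
      rwa [div_eq_inv_mul, ← one_div]

/-! ### Bernoulli `g`-values and their mean score -/

section

variable {Ω : Type*} [MeasurableSpace Ω] {P : Measure Ω} [IsProbabilityMeasure P]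

lemma integral_comp_fin_two {g : Ω → Fin 2} (hg : Measurable g) {p : ℝ}
    (h0 : P.real {ω | g ω = 0} = 1 - p) (h1 : P.real {ω | g ω = 1} = p) (h : Fin 2 → ℝ) :
    ∫ ω, h (g ω) ∂P = (1 - p) * h 0 + p * h 1 := by
  have hv (v : Fin 2) : (P.map g).real {v} = P.real {ω | g ω = v} :=
    map_measureReal_apply hg (measurableSet_singleton v)
  rw [← integral_map hg.aemeasurable (measurable_of_finite h).aestronglyMeasurable,
    integral_fintype (Integrable.of_finite), Fin.sum_univ_two, hv, hv, h0, h1]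
  simp

lemma memLp_comp_fin_two {g : Ω → Fin 2} (hg : Measurable g) (q : ENNReal) :
    MemLp (fun ω => ((g ω : ℕ) : ℝ)) q P := by
  refine MemLp.of_bound ((measurable_of_finite fun v : Fin 2 => ((v : ℕ) : ℝ)).comp
    hg).aestronglyMeasurable 1 (ae_of_all _ fun ω => ?_)
  rw [Real.norm_natCast]
  exact_mod_cast Nat.le_of_lt_succ (g ω).isLt

lemma integral_bernoulli {g : Ω → Fin 2} (hg : Measurable g) {p : ℝ}
    (h0 : P.real {ω | g ω = 0} = 1 - p) (h1 : P.real {ω | g ω = 1} = p) :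
    ∫ ω, ((g ω : ℕ) : ℝ) ∂P = p := by
  rw [integral_comp_fin_two hg h0 h1 fun v => ((v : ℕ) : ℝ)]
  simp

lemma variance_bernoulli {g : Ω → Fin 2} (hg : Measurable g) {p : ℝ}
    (h0 : P.real {ω | g ω = 0} = 1 - p) (h1 : P.real {ω | g ω = 1} = p) :
    Var[fun ω => ((g ω : ℕ) : ℝ); P] = p * (1 - p) := by
  rw [variance_eq_integral (memLp_comp_fin_two hg 2).aestronglyMeasurable.aemeasurable,
    integral_bernoulli hg h0 h1, integral_comp_fin_two hg h0 h1 fun v => (((v : ℕ) : ℝ) - p) ^ 2]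
  simp
  ring

lemma integral_sub_pow_four_bernoulli_le {g : Ω → Fin 2} (hg : Measurable g) {p : ℝ}
    (h0 : P.real {ω | g ω = 0} = 1 - p) (h1 : P.real {ω | g ω = 1} = p) :
    ∫ ω, (((g ω : ℕ) : ℝ) - p) ^ 4 ∂P ≤ p * (1 - p) := by
  have hp : 0 ≤ p := h1 ▸ measureReal_nonneg
  have hp' : 0 ≤ 1 - p := h0 ▸ measureReal_nonneg
  rw [integral_comp_fin_two hg h0 h1 fun v => (((v : ℕ) : ℝ) - p) ^ 4]
  have h : (1 - p) * (((0 : Fin 2) : ℕ) - p : ℝ) ^ 4 + p * (((1 : Fin 2) : ℕ) - p : ℝ) ^ 4 =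
      p * (1 - p) * (p ^ 3 + (1 - p) ^ 3) := by
    simp; ring
  rw [h]
  refine mul_le_of_le_one_right (by positivity) ?_
  nlinarith [mul_nonneg hp hp']

end

/-- The Lyapunov ratio of `n` Bernoulli variables whose variances are at least `c` is at most
`1 / (c n)`: the centered variables are bounded by `1`, so their fourth moments are at most their
variances. -/
lemma lyapunovRatio_bernoulli_le {Ω ι : Type*} [MeasurableSpace Ω] {P : Measure Ω}
    [IsProbabilityMeasure P] [Fintype ι] {g : ι → Ω → Fin 2} (hg : ∀ i, Measurable (g i))
    {p : ι → ℝ} (h0 : ∀ i, P.real {ω | g i ω = 0} = 1 - p i)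
    (h1 : ∀ i, P.real {ω | g i ω = 1} = p i) {c : ℝ} (hc : 0 < c)
    (hp : ∀ i, c ≤ p i * (1 - p i)) :
    lyapunovRatio P (fun i ω => ((g i ω : ℕ) : ℝ)) 2 ≤ 1 / (c * Fintype.card ι) := by
  simp_rw [lyapunovRatio_two, fun i => variance_bernoulli (hg i) (h0 i) (h1 i),
    fun i => integral_bernoulli (hg i) (h0 i) (h1 i)]
  set S := ∑ i, p i * (1 - p i)
  have hS : c * Fintype.card ι ≤ S := by
    have := Finset.card_nsmul_le_sum Finset.univ (fun i => p i * (1 - p i)) c fun i _ => hp i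
    rwa [nsmul_eq_mul, mul_comm, Finset.card_univ] at this
  have hS0 : 0 ≤ S := le_trans (by positivity) hS
  have hle : ∑ i, ∫ ω, (((g i ω : ℕ) : ℝ) - p i) ^ 4 ∂P ≤ S :=
    Finset.sum_le_sum fun i _ => integral_sub_pow_four_bernoulli_le (hg i) (h0 i) (h1 i)
  have hsqrt : Real.sqrt S ^ 4 = S ^ 2 := by
    rw [show 4 = 2 * 2 from rfl, pow_mul, Real.sq_sqrt hS0]
  rw [hsqrt]
  rcases isEmpty_or_nonempty ι with hι | hι
  · simp
  · have hcard : 0 < c * Fintype.card ι := by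
      have := Fintype.card_pos (α := ι)
      positivity
    have hSpos : 0 < S := hcard.trans_le hS
    calc 1 / S ^ 2 * ∑ i, ∫ ω, (((g i ω : ℕ) : ℝ) - p i) ^ 4 ∂P ≤ 1 / S ^ 2 * S := by gcongr
      _ = 1 / S := by field_simp
      _ ≤ _ := one_div_le_one_div_of_le hcard hS

lemma lyapunovRatio_two_nonneg {Ω ι : Type*} [MeasurableSpace Ω] [Fintype ι] (P : Measure Ω)
    (X : ι → Ω → ℝ) : 0 ≤ lyapunovRatio P X 2 := by
  rw [lyapunovRatio_two]
  refine mul_nonneg (by positivity) (Finset.sum_nonneg fun i _ => integral_nonneg fun ω => ?_)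
  exact Even.pow_nonneg (by decide) _

lemma meanScore_eq {Ω : Type*} {T m : ℕ} (g : Fin T → Fin m → Ω → Fin 2) :
    meanScore g = fun ω => 1 / ((m : ℝ) * (T : ℝ)) *
      ∑ i : Fin T × Fin m, ((g i.1 i.2 ω : ℕ) : ℝ) := by
  ext ω
  rw [meanScore, Fintype.sum_prod_type, mul_comm (T : ℝ)]

section

variable {Ω : Type*} [MeasurableSpace Ω] {P : Measure Ω} [IsProbabilityMeasure P] {T m : ℕ}
  {g : Fin T → Fin m → Ω → Fin 2} {p : Fin T → Fin m → ℝ}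

lemma integral_meanScore (hg : ∀ t l, Measurable (g t l))
    (h0 : ∀ t l, P.real {ω | g t l ω = 0} = 1 - p t l)
    (h1 : ∀ t l, P.real {ω | g t l ω = 1} = p t l) :
    ∫ ω, meanScore g ω ∂P = 1 / ((m : ℝ) * (T : ℝ)) * ∑ t, ∑ l, p t l := by
  rw [meanScore_eq, integral_const_mul, integral_finsetSum _ fun i _ =>
    (memLp_comp_fin_two (hg i.1 i.2) 1).integrable le_rfl, Fintype.sum_prod_type]
  simp_rw [fun t l => integral_bernoulli (hg t l) (h0 t l) (h1 t l)]

lemma variance_meanScore (hg : ∀ t l, Measurable (g t l))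
    (hind : iIndepFun (fun i : Fin T × Fin m => g i.1 i.2) P)
    (h0 : ∀ t l, P.real {ω | g t l ω = 0} = 1 - p t l)
    (h1 : ∀ t l, P.real {ω | g t l ω = 1} = p t l) :
    Var[meanScore g; P] =
      (1 / ((m : ℝ) * (T : ℝ))) ^ 2 * ∑ t, ∑ l, p t l * (1 - p t l) := by
  have hindep := hind.comp (fun _ v => ((v : ℕ) : ℝ)) fun _ => measurable_of_finite _
  have hsum := IndepFun.variance_sum (s := Finset.univ)
    (fun (i : Fin T × Fin m) _ => memLp_comp_fin_two (P := P) (hg i.1 i.2) 2)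
    fun i _ j _ hij => hindep.indepFun hij
  rw [Finset.sum_fn, Fintype.sum_prod_type] at hsum
  rw [meanScore_eq, variance_const_mul, hsum]
  simp_rw [fun t l => variance_bernoulli (hg t l) (h0 t l) (h1 t l)]

end

/-- The common factor `1 / (m T)` cancels when the mean score is standardized. In an empty array
both sides are zero. -/
lemma meanScore_standardized_eq {Ω : Type*} {T m : ℕ} (g : Fin T → Fin m → Ω → Fin 2)
    (p v : Fin T → Fin m → ℝ) (ω : Ω) :
    (meanScore g ω - 1 / ((m : ℝ) * (T : ℝ)) * ∑ t, ∑ l, p t l) /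
        Real.sqrt ((1 / ((m : ℝ) * (T : ℝ))) ^ 2 * ∑ t, ∑ l, v t l) =
      ∑ i : Fin T × Fin m, (((g i.1 i.2 ω : ℕ) : ℝ) - p i.1 i.2) /
        Real.sqrt (∑ i : Fin T × Fin m, v i.1 i.2) := by
  rw [meanScore_eq, ← Finset.sum_div, Finset.sum_sub_distrib,
    Fintype.sum_prod_type (fun i : Fin T × Fin m => p i.1 i.2),
    Fintype.sum_prod_type (fun i : Fin T × Fin m => v i.1 i.2), ← mul_sub,
    Real.sqrt_mul (sq_nonneg _), Real.sqrt_sq (by positivity)]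
  rcases Nat.eq_zero_or_pos (m * T) with h | h
  · rcases Nat.mul_eq_zero.1 h with rfl | rfl <;> simp
  · have hmT : (m : ℝ) * T ≠ 0 := by exact_mod_cast h.ne'
    exact mul_div_mul_left _ _ (one_div_ne_zero hmT)

/-- For `C ∈ [0, 1]` the variance of a watermarked `g`-value is bounded away from zero. -/
lemma three_div_sixteen_le {C : ℝ} (hC : C ∈ Set.Icc (0 : ℝ) 1) :
    3 / 16 ≤ (3 - C) / 4 * (1 - (3 - C) / 4) := by
  obtain ⟨h0, h1⟩ := hC
  nlinarith

section

variable {m T : ℕ → ℕ} {Ω : ℕ → Type*} [∀ k, MeasurableSpace (Ω k)] {P : ∀ k, Measure (Ω k)}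
  [∀ k, IsProbabilityMeasure (P k)] {g : ∀ k, Fin (T k) → Fin (m k) → Ω k → Fin 2}
  {p : ∀ k, Fin (T k) → Fin (m k) → ℝ} {c : ℝ}

lemma tendsto_lyapunovRatio_bernoulli (hmT : Tendsto (fun k => m k * T k) atTop atTop)
    (hg : ∀ k t l, Measurable (g k t l))
    (h0 : ∀ k t l, (P k).real {ω | g k t l ω = 0} = 1 - p k t l)
    (h1 : ∀ k t l, (P k).real {ω | g k t l ω = 1} = p k t l) (hc : 0 < c)
    (hp : ∀ k t l, c ≤ p k t l * (1 - p k t l)) :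
    Tendsto (fun k => lyapunovRatio (P k)
      (fun (i : Fin (T k) × Fin (m k)) ω => ((g k i.1 i.2 ω : ℕ) : ℝ)) 2) atTop (𝓝 0) := by
  refine squeeze_zero (fun k => lyapunovRatio_two_nonneg _ _)
    (fun k => lyapunovRatio_bernoulli_le (g := fun i : Fin (T k) × Fin (m k) => g k i.1 i.2)
      (p := fun i => p k i.1 i.2) (fun i => hg k i.1 i.2) (fun i => h0 k i.1 i.2)
      (fun i => h1 k i.1 i.2) hc fun i => hp k i.1 i.2) ?_
  simp only [one_div, Fintype.card_prod, Fintype.card_fin, mul_comm (T _)]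
  exact ((tendsto_natCast_atTop_atTop.comp hmT).const_mul_atTop hc).inv_tendsto_atTop

lemma tendstoInDistribution_meanScore (hmT : Tendsto (fun k => m k * T k) atTop atTop)
    (hg : ∀ k t l, Measurable (g k t l))
    (hind : ∀ k, iIndepFun (fun i : Fin (T k) × Fin (m k) => g k i.1 i.2) (P k))
    (h0 : ∀ k t l, (P k).real {ω | g k t l ω = 0} = 1 - p k t l)
    (h1 : ∀ k t l, (P k).real {ω | g k t l ω = 1} = p k t l) (hc : 0 < c)
    (hp : ∀ k t l, c ≤ p k t l * (1 - p k t l)) :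
    TendstoInDistribution
      (fun k ω => (meanScore (g k) ω - 1 / ((m k : ℝ) * (T k : ℝ)) * ∑ t, ∑ l, p k t l) /
        Real.sqrt ((1 / ((m k : ℝ) * (T k : ℝ))) ^ 2 * ∑ t, ∑ l, p k t l * (1 - p k t l)))
      atTop (id : ℝ → ℝ) P (gaussianReal 0 1) := by
  have hvar (k) (i : Fin (T k) × Fin (m k)) :=
    variance_bernoulli (hg k i.1 i.2) (h0 k i.1 i.2) (h1 k i.1 i.2)
  have hmean (k) (i : Fin (T k) × Fin (m k)) :=
    integral_bernoulli (hg k i.1 i.2) (h0 k i.1 i.2) (h1 k i.1 i.2)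
  have hpos (k) (hk : 0 < m k * T k) :
      0 < ∑ i : Fin (T k) × Fin (m k), Var[fun ω => ((g k i.1 i.2 ω : ℕ) : ℝ); P k] := by
    have : Nonempty (Fin (T k) × Fin (m k)) := by
      rw [← Fintype.card_pos_iff, Fintype.card_prod, Fintype.card_fin, Fintype.card_fin, mul_comm]
      exact hk
    refine Finset.sum_pos (fun i _ => ?_) Finset.univ_nonempty
    rw [hvar]
    exact hc.trans_le (hp k i.1 i.2)
  have hclt := tendstoInDistribution_of_lyapunovRatio
    (X := fun k (i : Fin (T k) × Fin (m k)) ω => ((g k i.1 i.2 ω : ℕ) : ℝ))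
    (fun k i => memLp_comp_fin_two (hg k i.1 i.2) 4)
    (fun k => (hind k).comp (fun _ v => ((v : ℕ) : ℝ)) fun _ => measurable_of_finite _)
    ((hmT.eventually_gt_atTop 0).mono hpos) (tendsto_lyapunovRatio_bernoulli hmT hg h0 h1 hc hp)
  simp only [hvar, hmean] at hclt
  simp only [fun k ω => meanScore_standardized_eq (g k) (p k)
    (fun t l => p k t l * (1 - p k t l)) ω]
  exact hclt

end

end SynthID

theorem mainTheorem12 :
    -- one layer of the tournament yields the watermarked `g`-value distribution
    (∀ (V : Type*) [Fintype V] (p : PMF V),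
      SynthID.collisionProb p ∈ Set.Icc (0 : ℝ) 1 ∧
      ∀ v, (SynthID.matchLaw p v).toReal =
        SynthID.watermarkedPmf SynthID.gDist (SynthID.collisionProb p) v) ∧
    -- watermarked texts with `T k` tokens and `m k` layers, `m k * T k → ∞`
    ∀ (m T : ℕ → ℕ) (_ : Tendsto (fun k => m k * T k) atTop atTop)
      (Ω : ℕ → Type*) [∀ k, MeasurableSpace (Ω k)]
      (P : ∀ k, Measure (Ω k)) [∀ k, IsProbabilityMeasure (P k)]
      (C : ∀ k, Fin (T k) → Fin (m k) → ℝ) (_ : ∀ k t l, C k t l ∈ Set.Icc (0 : ℝ) 1)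
      (g : ∀ k, Fin (T k) → Fin (m k) → Ω k → Fin 2)
      (_ : ∀ k t l, Measurable (g k t l))
      (_ : ∀ k, iIndepFun (fun i : Fin (T k) × Fin (m k) => g k i.1 i.2) (P k))
      (_ : ∀ k t l v, (P k).real {ω | g k t l ω = v} =
        SynthID.watermarkedPmf SynthID.gDist (C k t l) v),
      -- each `g`-value is Bernoulli with parameter `(3 - C) / 4 ∈ [1/2, 3/4]`
      (∀ k t l, (3 - C k t l) / 4 ∈ Set.Icc (1 / 2 : ℝ) (3 / 4) ∧
        (P k).real {ω | g k t l ω = 1} = (3 - C k t l) / 4 ∧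
        (P k).real {ω | g k t l ω = 0} = 1 - (3 - C k t l) / 4) ∧
      -- mean and variance of the mean score
      (∀ k, ∫ ω, SynthID.meanScore (g k) ω ∂(P k) =
        1 / ((m k : ℝ) * (T k : ℝ)) * ∑ t, ∑ l, (3 - C k t l) / 4) ∧
      (∀ k, Var[SynthID.meanScore (g k); P k] =
        (1 / ((m k : ℝ) * (T k : ℝ))) ^ 2 *
          ∑ t, ∑ l, (3 - C k t l) / 4 * (1 - (3 - C k t l) / 4)) ∧
      -- the Lyapunov condition with `δ = 2`
      Tendsto (fun k => SynthID.lyapunovRatio (P k)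
        (fun (i : Fin (T k) × Fin (m k)) ω => ((g k i.1 i.2 ω : ℕ) : ℝ)) 2) atTop (𝓝 0) ∧
      -- asymptotic normality with this mean and variance
      TendstoInDistribution
        (fun k ω =>
          (SynthID.meanScore (g k) ω -
            1 / ((m k : ℝ) * (T k : ℝ)) * ∑ t, ∑ l, (3 - C k t l) / 4) /
          Real.sqrt ((1 / ((m k : ℝ) * (T k : ℝ))) ^ 2 *
            ∑ t, ∑ l, (3 - C k t l) / 4 * (1 - (3 - C k t l) / 4)))
        atTop (id : ℝ → ℝ) P (gaussianReal 0 1) := by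
  refine ⟨fun V _ p => ⟨SynthID.collisionProb_mem_Icc p, SynthID.toReal_matchLaw p⟩, ?_⟩
  intro m T hmT Ω _ P _ C hC g hg hind hlaw
  have h0 (k t l) : (P k).real {ω | g k t l ω = 0} = 1 - (3 - C k t l) / 4 :=
    (hlaw k t l 0).trans (SynthID.watermarkedPmf_gDist_zero _)
  have h1 (k t l) : (P k).real {ω | g k t l ω = 1} = (3 - C k t l) / 4 :=
    (hlaw k t l 1).trans (SynthID.watermarkedPmf_gDist_one _)
  have hvar (k t l) := SynthID.three_div_sixteen_le (hC k t l)
  have hpos : (0 : ℝ) < 3 / 16 := by norm_num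
  refine ⟨fun k t l => ⟨?_, h1 k t l, h0 k t l⟩,
    fun k => SynthID.integral_meanScore (hg k) (h0 k) (h1 k),
    fun k => SynthID.variance_meanScore (hg k) (hind k) (h0 k) (h1 k),
    SynthID.tendsto_lyapunovRatio_bernoulli hmT hg h0 h1 hpos hvar,
    SynthID.tendstoInDistribution_meanScore hmT hg hind h0 h1 hpos hvar⟩
  obtain ⟨hC0, hC1⟩ := hC k t l
  constructor <;> linarith
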